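/- Conventions. For a finite bipartite graph $G$ with an upper layer of $n$ nodes and a lower layer of $n$ nodes, a perfect matching of $G$ is identified with the $n\times n$ permutation matrix having a $1$ at position $(i,j)$ if and only if the matching contains the edge between the $i$-th upper and the $j$-th lower node. $G$ is a \emph{face graph} if each of its edges is contained in a perfect matching of $G$; its associated face $\operatorname{face}(G)$ is the convex hull of the matrices of its perfect matchings, a face of the Birkhoff polytope $B_n=\operatorname{conv}\{M(\sigma):\sigma\in S_n\}\subset\mathbb R^{n\times n}$. Two polytopes are combinatorially equivalent if their face lattices are isomorphic as posets. If $F$ is a face of a polytope $Q\subset\mathbb R^m$ and $\langle c,x\rangle\le\delta$ is a linear inequality valid on $Q$ with $F=\{x\in Q:\langle c,x\rangle=\delta\}$, let \[\wedge_F(Q)=\{(x,x_0)\in\mathbb R^{m+1} : x\in Q,\ 0\le x_0\le\delta-\langle c,x\rangle\}.\] A polytope $P$ is a \emph{wedge of $Q$ over $F$} if $P$ is combinatorially equivalent to $\wedge_F(Q)$ (for every such choice of the inequality defining $F$). Theorem. Let $G$ be a face graph with $n\ge 3$ nodes in each layer, and let $u$ (in the upper layer) and $v$ (in the lower layer) be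 two adjacent nodes of degree $2$. Let $G'$ be the graph obtained by attaching a path of length $3$ to $u$ and $v$, i.e. by adding a new upper node $u'$ and a new lower node $v'$ together with the edges $uv'$, $u'v'$ and $u'v$. Then $G'$ is a face graph (so $\operatorname{face}(G')$ is a face of $B_{n+1}$). Moreover, the convex hull $R$ of the matrices of the perfect matchings of $G$ that do not contain the edge $uv$ is a nonempty face of $\operatorname{face}(G)$, and $\operatorname{face}(G')$ is a wedge of $\operatorname{face}(G)$ over $R$. -/

import Mathlib

/-! ### Polytopes, combinatorial equivalence, wedges -/

section Polytopes

variable {E E' : Type*} [AddCommGroup E] [Module ℝ E] [TopologicalSpace E]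
  [AddCommGroup E'] [Module ℝ E'] [TopologicalSpace E']

/-- The faces of `P`, ordered by inclusion: the empty set, and all sets of maximizers over `P` of a
linear functional (the zero functional gives `P` itself). -/
abbrev FaceLattice (P : Set E) : Type _ := {A : Set E // IsExposed ℝ P A}

/-- `P` and `Q` are combinatorially equivalent: their face lattices are isomorphic as posets. -/
def CombEquiv (P : Set E) (Q : Set E') : Prop :=
  Nonempty (FaceLattice P ≃o FaceLattice Q)

/-- The inequality `c x ≤ δ` is valid on `Q` and defines the face `F` of `Q`. -/
def DefinesFace (Q F : Set E) (c : E →L[ℝ] ℝ) (δ : ℝ) : Prop :=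
  (∀ x ∈ Q, c x ≤ δ) ∧ F = {x ∈ Q | c x = δ}

/-- The geometric wedge of `Q` over the face of `Q` defined by `c x ≤ δ`. -/
def geomWedge (Q : Set E) (c : E →L[ℝ] ℝ) (δ : ℝ) : Set (E × ℝ) :=
  {p | p.1 ∈ Q ∧ 0 ≤ p.2 ∧ p.2 ≤ δ - c p.1}

/-- `P` is a wedge of `Q` over `F`: the set `F` is a face of `Q`, and `P` is combinatorially
equivalent to the geometric wedge of `Q` over `F`, whichever inequality is chosen to define `F`. -/
def IsWedgeOver (P : Set E') (Q F : Set E) : Prop :=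
  (∃ c δ, DefinesFace Q F c δ) ∧
    ∀ c δ, DefinesFace Q F c δ → CombEquiv P (geomWedge Q c δ)

end Polytopes

/-! ### Face graphs and their faces

The nodes of a bipartite graph with layers of size `n` are `Fin n ⊕ Fin n`: the nodes `Sum.inl i`
form the upper layer (rows), the nodes `Sum.inr j` the lower layer (columns). -/

/-- The `n`-th Birkhoff polytope. -/
def birkhoffPolytope (n : ℕ) : Set (Matrix (Fin n) (Fin n) ℝ) :=
  convexHull ℝ (Set.range fun σ : Equiv.Perm (Fin n) => σ.permMatrix ℝ)

/-- A face graph: a bipartite graph with respect to the two layers such that every edge lies in a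
perfect matching. -/
def IsFaceGraph {n : ℕ} (G : SimpleGraph (Fin n ⊕ Fin n)) : Prop :=
  G.IsBipartiteWith (Set.range Sum.inl) (Set.range Sum.inr) ∧
    ∀ e ∈ G.edgeSet, ∃ M : G.Subgraph, M.IsPerfectMatching ∧ e ∈ M.edgeSet

open Classical in
/-- The `0/1`-matrix with a one at `(i, j)` exactly if the edge between node `i` of the upper layer
and node `j` of the lower layer belongs to `M`; a permutation matrix if `M` is a perfect
matching of a bipartite graph. -/
noncomputable def matchingMatrix {n : ℕ} {G : SimpleGraph (Fin n ⊕ Fin n)} (M : G.Subgraph) :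
    Matrix (Fin n) (Fin n) ℝ :=
  Matrix.of fun i j => if M.Adj (Sum.inl i) (Sum.inr j) then 1 else 0

/-- The face of the Birkhoff polytope associated with `G`: the convex hull of the permutation
matrices given by the perfect matchings of `G`. -/
def graphFace {n : ℕ} (G : SimpleGraph (Fin n ⊕ Fin n)) : Set (Matrix (Fin n) (Fin n) ℝ) :=
  convexHull ℝ {x | ∃ M : G.Subgraph, M.IsPerfectMatching ∧ x = matchingMatrix M}

/-- The convex hull of the permutation matrices given by the perfect matchings of `G` that do not
contain the edge `e`. -/
def avoidingFace {n : ℕ} (G : SimpleGraph (Fin n ⊕ Fin n)) (e : Sym2 (Fin n ⊕ Fin n)) :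
    Set (Matrix (Fin n) (Fin n) ℝ) :=
  convexHull ℝ {x | ∃ M : G.Subgraph, M.IsPerfectMatching ∧ e ∉ M.edgeSet ∧ x = matchingMatrix M}

/-- The graph obtained from `G` by attaching a path of length `3` to the node `u` of the upper and
the node `v` of the lower layer: a new node `u'` of the upper layer and a new node `v'` of
the lower layer (the last ones) are added, together with the edges of the path `u, v', u', v`. -/
def attachPath {n : ℕ} (G : SimpleGraph (Fin n ⊕ Fin n)) (u v : Fin n) :
    SimpleGraph (Fin (n + 1) ⊕ Fin (n + 1)) :=
  G.map (Function.Embedding.sumMap Fin.castSuccEmb Fin.castSuccEmb) ⊔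
    SimpleGraph.edge (Sum.inl u.castSucc) (Sum.inr (Fin.last n)) ⊔
    SimpleGraph.edge (Sum.inr (Fin.last n)) (Sum.inl (Fin.last n)) ⊔
    SimpleGraph.edge (Sum.inl (Fin.last n)) (Sum.inr v.castSucc)

/-! Write `u'` and `v'` for the new upper and lower node. A perfect matching of `G'` either contains
`u'v'`, and is then a perfect matching of `G` plus that edge, or contains `uv'` and `u'v`, and then
comes from a perfect matching of `G` through `uv` by rerouting `uv` along the path
(`isAdapted_attachPath_iff`). So the vertices of `face(G')` correspond to the pairs (M, 0) for all
M, and (M, 1) for those M that contain `uv`. The matchings avoiding `uv` span the face on which the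
valid inequality `-x u v ≤ 0` is tight. The wedge for this inequality consists of the (x, t) with `0
≤ t ≤ x u v`, and shifting the amount t from `uv` to the path maps it affinely and bijectively onto
`face(G')` (`combEquiv_graphFace_attachPath`). Any other inequality defining the same face gives a
wedge of the same combinatorial type (`combEquiv_geomWedge`): rescaling each fibre is in general not
affine, but it preserves bottom, top and fibres, and every face of a wedge is described by these. -/

section Polytopes

variable {E V : Type*} [AddCommGroup E] [Module ℝ E] [TopologicalSpace E]
  [AddCommGroup V] [Module ℝ V] [TopologicalSpace V]

/-! ### Criteria for combinatorial equivalence -/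

/-- Mutually inverse bijections that carry faces to faces induce a combinatorial equivalence. -/
theorem CombEquiv.of_invOn {P : Set E} {Q : Set V} (φ : E → V) (ψ : V → E)
    (hψφ : ∀ x ∈ P, ψ (φ x) = x) (hφψ : ∀ y ∈ Q, φ (ψ y) = y)
    (h : ∀ A, IsExposed ℝ P A → IsExposed ℝ Q (φ '' A))
    (h' : ∀ A, IsExposed ℝ Q A → IsExposed ℝ P (ψ '' A)) : CombEquiv P Q := by
  have key : ∀ A, IsExposed ℝ P A → ψ '' (φ '' A) = A := fun A hA => by
    rw [Set.image_image]
    exact (Set.image_congr fun x hx => hψφ x (hA.subset hx)).trans (Set.image_id' A)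
  have key' : ∀ A, IsExposed ℝ Q A → φ '' (ψ '' A) = A := fun A hA => by
    rw [Set.image_image]
    exact (Set.image_congr fun x hx => hφψ x (hA.subset hx)).trans (Set.image_id' A)
  exact ⟨{
    toFun := fun A => ⟨φ '' A.1, h A.1 A.2⟩
    invFun := fun A => ⟨ψ '' A.1, h' A.1 A.2⟩
    left_inv := fun A => Subtype.ext (key A.1 A.2)
    right_inv := fun A => Subtype.ext (key' A.1 A.2)
    map_rel_iff' := by
      intro A B
      refine ⟨fun hAB => ?_, fun hAB => Set.image_mono hAB⟩
      have := Set.image_mono (f := ψ) (show φ '' A.1 ⊆ φ '' B.1 from hAB)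
      rwa [key A.1 A.2, key B.1 B.2] at this }⟩

theorem CombEquiv.trans {W : Type*} [AddCommGroup W] [Module ℝ W] [TopologicalSpace W]
    {P : Set E} {Q : Set V} {R : Set W} (h : CombEquiv P Q) (h' : CombEquiv Q R) :
    CombEquiv P R :=
  h.elim fun e => h'.elim fun f => ⟨e.trans f⟩

/-- The image of an exposed set under a bijection whose inverse is affine is exposed. -/
theorem IsExposed.image_of_affine {P : Set E} {Q : Set V} {φ : E → V} {ψ : V → E}
    (hφ : ∀ x ∈ P, φ x ∈ Q) (hψ : ∀ y ∈ Q, ψ y ∈ P)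
    (hψφ : ∀ x ∈ P, ψ (φ x) = x) (hφψ : ∀ y ∈ Q, φ (ψ y) = y)
    (haff : ∀ l : E →L[ℝ] ℝ, ∃ (l' : V →L[ℝ] ℝ) (k : ℝ), ∀ y ∈ Q, l (ψ y) = l' y + k)
    {A : Set E} (hA : IsExposed ℝ P A) : IsExposed ℝ Q (φ '' A) := by
  intro hne
  obtain ⟨l, hl⟩ := hA (Set.image_nonempty.1 hne)
  -- The pullback of `l` along `ψ` is linear only up to the constant `k`, which does not affect the
  -- set of maximizers.
  obtain ⟨l', k, hk⟩ := haff l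
  refine ⟨l', Set.Subset.antisymm ?_ ?_⟩
  · rintro _ ⟨x, hx, rfl⟩
    rw [hl] at hx
    refine ⟨hφ x hx.1, fun y hy => ?_⟩
    have h1 := hx.2 (ψ y) (hψ y hy)
    have h2 := hk _ (hφ x hx.1)
    rw [hψφ x hx.1] at h2
    linarith [hk y hy]
  · rintro y ⟨hy, hmax⟩
    refine ⟨ψ y, ?_, hφψ y hy⟩
    rw [hl]
    refine ⟨hψ y hy, fun x hx => ?_⟩
    have h1 := hmax (φ x) (hφ x hx)
    have h2 := hk _ (hφ x hx)
    rw [hψφ x hx] at h2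
    linarith [hk y hy]

theorem CombEquiv.of_affine {P : Set E} {Q : Set V} (φ : E → V) (ψ : V → E)
    (hφ : ∀ x ∈ P, φ x ∈ Q) (hψ : ∀ y ∈ Q, ψ y ∈ P)
    (hψφ : ∀ x ∈ P, ψ (φ x) = x) (hφψ : ∀ y ∈ Q, φ (ψ y) = y)
    (hφaff : ∀ l : V →L[ℝ] ℝ, ∃ (l' : E →L[ℝ] ℝ) (k : ℝ), ∀ x ∈ P, l (φ x) = l' x + k)
    (hψaff : ∀ l : E →L[ℝ] ℝ, ∃ (l' : V →L[ℝ] ℝ) (k : ℝ), ∀ y ∈ Q, l (ψ y) = l' y + k) :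
    CombEquiv P Q :=
  CombEquiv.of_invOn φ ψ hψφ hφψ
    (fun _ hA => hA.image_of_affine hφ hψ hψφ hφψ hψaff)
    (fun _ hA => hA.image_of_affine hψ hφ hφψ hψφ hφaff)

/-! ### Independence of the wedge from the defining inequality -/

/-- The fibrewise rescaling between two wedges of the same base. -/
noncomputable def wedgeRescale (c : E →L[ℝ] ℝ) (δ : ℝ) (d : E →L[ℝ] ℝ) (ε : ℝ) (p : E × ℝ) :
    E × ℝ :=
  (p.1, p.2 * (ε - d p.1) / (δ - c p.1))

section Rescale

variable {Q : Set E} {c d : E →L[ℝ] ℝ} {δ ε : ℝ}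

theorem wedgeRescale_mem (hc : ∀ x ∈ Q, c x ≤ δ) (hd : ∀ x ∈ Q, d x ≤ ε)
    {p : E × ℝ} (hp : p ∈ geomWedge Q c δ) : wedgeRescale c δ d ε p ∈ geomWedge Q d ε := by
  obtain ⟨h1, h2, h3⟩ := hp
  have hf : 0 ≤ δ - c p.1 := sub_nonneg.2 (hc _ h1)
  have hg : 0 ≤ ε - d p.1 := sub_nonneg.2 (hd _ h1)
  refine ⟨h1, div_nonneg (mul_nonneg h2 hg) hf, ?_⟩
  change p.2 * (ε - d p.1) / (δ - c p.1) ≤ ε - d p.1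
  refine div_le_of_le_mul₀ hf hg ?_
  rw [mul_comm]
  exact mul_le_mul_of_nonneg_left h3 hg

/-- Off the face both denominators are nonzero and the factors cancel. Over the face the fibre is
the single height 0, and division by zero returns exactly this value. -/
theorem wedgeRescale_wedgeRescale (h0 : ∀ x ∈ Q, c x = δ ↔ d x = ε)
    {p : E × ℝ} (hp : p ∈ geomWedge Q c δ) :
    wedgeRescale d ε c δ (wedgeRescale c δ d ε p) = p := by
  obtain ⟨h1, h2, h3⟩ := hp
  refine Prod.ext rfl ?_
  change p.2 * (ε - d p.1) / (δ - c p.1) * (δ - c p.1) / (ε - d p.1) = p.2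
  by_cases h : c p.1 = δ
  · have : p.2 = 0 := le_antisymm (by linarith) h2
    simp [this]
  · have hf : δ - c p.1 ≠ 0 := fun h' => h (by linarith)
    have hg : ε - d p.1 ≠ 0 := fun h' => h ((h0 _ h1).2 (by linarith))
    field_simp

theorem wedgeRescale_bottom (x : E) : wedgeRescale c δ d ε (x, 0) = (x, 0) := by
  simp [wedgeRescale]

theorem wedgeRescale_top (h0 : ∀ x ∈ Q, c x = δ ↔ d x = ε) {x : E} (hx : x ∈ Q) :
    wedgeRescale c δ d ε (x, δ - c x) = (x, ε - d x) := by
  refine Prod.ext rfl ?_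
  change (δ - c x) * (ε - d x) / (δ - c x) = ε - d x
  by_cases h : c x = δ
  · rw [(h0 x hx).1 h, h]; simp
  · have hf : δ - c x ≠ 0 := fun h' => h (by linarith)
    field_simp

theorem bottom_mem_geomWedge (hc : ∀ x ∈ Q, c x ≤ δ) {x : E} (hx : x ∈ Q) :
    (x, (0 : ℝ)) ∈ geomWedge Q c δ :=
  ⟨hx, le_rfl, sub_nonneg.2 (hc x hx)⟩

theorem top_mem_geomWedge (hc : ∀ x ∈ Q, c x ≤ δ) {x : E} (hx : x ∈ Q) :
    (x, δ - c x) ∈ geomWedge Q c δ :=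
  ⟨hx, sub_nonneg.2 (hc x hx), le_rfl⟩

/-- A functional with negative last coefficient exposes a face of the bottom of the wedge. -/
theorem mem_maximizers_geomWedge_of_neg (hc : ∀ x ∈ Q, c x ≤ δ) (m : E →L[ℝ] ℝ) {a : ℝ}
    (ha : a < 0) (p : E × ℝ) :
    (p ∈ geomWedge Q c δ ∧ ∀ q ∈ geomWedge Q c δ, m q.1 + a * q.2 ≤ m p.1 + a * p.2) ↔
      p.1 ∈ Q ∧ (∀ y ∈ Q, m y ≤ m p.1) ∧ p.2 = 0 := by
  constructor
  · rintro ⟨hp, hmax⟩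
    have h1 : a * 0 ≤ a * p.2 := by
      have := hmax _ (bottom_mem_geomWedge hc hp.1)
      simpa using this
    have h2 : p.2 = 0 := le_antisymm (by nlinarith) hp.2.1
    refine ⟨hp.1, fun y hy => ?_, h2⟩
    have := hmax _ (bottom_mem_geomWedge hc hy)
    simpa [h2] using this
  · rintro ⟨hp, hmax, h2⟩
    refine ⟨⟨hp, h2.ge, by rw [h2]; exact sub_nonneg.2 (hc _ hp)⟩, fun q hq => ?_⟩
    rw [h2, mul_zero, add_zero]
    linarith [hmax _ hq.1, mul_nonpos_of_nonpos_of_nonneg ha.le hq.2.1]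

/-- A functional with positive last coefficient exposes a face of the top of the wedge. -/
theorem mem_maximizers_geomWedge_of_pos (hc : ∀ x ∈ Q, c x ≤ δ) (m : E →L[ℝ] ℝ) {a : ℝ}
    (ha : 0 < a) (p : E × ℝ) :
    (p ∈ geomWedge Q c δ ∧ ∀ q ∈ geomWedge Q c δ, m q.1 + a * q.2 ≤ m p.1 + a * p.2) ↔
      p.1 ∈ Q ∧ (∀ y ∈ Q, m y - a * c y ≤ m p.1 - a * c p.1) ∧ p.2 = δ - c p.1 := by
  constructor
  · rintro ⟨hp, hmax⟩
    have h1 : a * (δ - c p.1) ≤ a * p.2 := by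
      have := hmax _ (top_mem_geomWedge hc hp.1)
      simpa using this
    have h2 : p.2 = δ - c p.1 := le_antisymm hp.2.2 (le_of_mul_le_mul_left h1 ha)
    refine ⟨hp.1, fun y hy => ?_, h2⟩
    have := hmax _ (top_mem_geomWedge hc hy)
    rw [h2] at this
    dsimp only at this
    linarith
  · rintro ⟨hp, hmax, h2⟩
    refine ⟨⟨hp, by rw [h2]; exact sub_nonneg.2 (hc _ hp), h2.le⟩, fun q hq => ?_⟩
    rw [h2]
    linarith [hmax _ hq.1, mul_le_mul_of_nonneg_left hq.2.2 ha.le]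

/-- A functional that ignores the last coordinate exposes the wedge over a face of the base. -/
theorem mem_maximizers_geomWedge_of_zero (hc : ∀ x ∈ Q, c x ≤ δ) (m : E →L[ℝ] ℝ) (p : E × ℝ) :
    (p ∈ geomWedge Q c δ ∧ ∀ q ∈ geomWedge Q c δ, m q.1 + 0 * q.2 ≤ m p.1 + 0 * p.2) ↔
      p ∈ geomWedge Q c δ ∧ ∀ y ∈ Q, m y ≤ m p.1 := by
  refine and_congr_right fun hp => ⟨fun h y hy => ?_, fun h q hq => ?_⟩
  · simpa using h _ (bottom_mem_geomWedge hc hy)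
  · simpa using h _ hq.1

theorem ContinuousLinearMap.apply_prod_real (l : E × ℝ →L[ℝ] ℝ) (p : E × ℝ) :
    l p = l.comp (.inl ℝ E ℝ) p.1 + l (0, 1) * p.2 := by
  have : p = (p.1, 0) + p.2 • ((0, 1) : E × ℝ) := by ext <;> simp
  conv_lhs => rw [this, map_add, map_smul]
  simp [mul_comm]

/-- The sign of the last coefficient `a` of an exposing functional decides whether its face lies in
the bottom, lies in the top, or is a union of whole fibres. Each kind is described by maximizers on
the base alone, so a functional for the other wedge can be written down. -/
theorem IsExposed.image_wedgeRescale [IsTopologicalAddGroup E] [ContinuousSMul ℝ E]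
    (hc : ∀ x ∈ Q, c x ≤ δ) (hd : ∀ x ∈ Q, d x ≤ ε)
    (h0 : ∀ x ∈ Q, c x = δ ↔ d x = ε) {A : Set (E × ℝ)} (hA : IsExposed ℝ (geomWedge Q c δ) A) :
    IsExposed ℝ (geomWedge Q d ε) (wedgeRescale c δ d ε '' A) := by
  intro hne
  obtain ⟨l, hl⟩ := hA (Set.image_nonempty.1 hne)
  have h0' : ∀ x ∈ Q, d x = ε ↔ c x = δ := fun x hx => (h0 x hx).symm
  set m : E →L[ℝ] ℝ := l.comp (.inl ℝ E ℝ) with hm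
  set a : ℝ := l (0, 1) with ha
  have hA' : ∀ p, p ∈ A ↔ (p ∈ geomWedge Q c δ ∧
      ∀ q ∈ geomWedge Q c δ, m q.1 + a * q.2 ≤ m p.1 + a * p.2) := by
    intro p
    rw [hl]
    refine and_congr_right fun _ => forall₂_congr fun q _ => ?_
    rw [l.apply_prod_real q, l.apply_prod_real p]
  have mk : ∀ (m' : E →L[ℝ] ℝ) (b : ℝ), (∀ p, p ∈ wedgeRescale c δ d ε '' A ↔
      (p ∈ geomWedge Q d ε ∧ ∀ q ∈ geomWedge Q d ε, m' q.1 + b * q.2 ≤ m' p.1 + b * p.2)) →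
      ∃ l' : E × ℝ →L[ℝ] ℝ, wedgeRescale c δ d ε '' A =
        {x ∈ geomWedge Q d ε | ∀ y ∈ geomWedge Q d ε, l' y ≤ l' x} := by
    intro m' b h
    refine ⟨m'.comp (.fst ℝ E ℝ) + b • .snd ℝ E ℝ, Set.ext fun p => (h p).trans ?_⟩
    simp
  rcases lt_trichotomy a 0 with hneg | hzero | hpos
  · refine mk m a fun p => ?_
    rw [mem_maximizers_geomWedge_of_neg hd m hneg]
    simp only [mem_maximizers_geomWedge_of_neg hc m hneg] at hA'
    constructor
    · rintro ⟨⟨x, t⟩, hp, rfl⟩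
      obtain ⟨h1, h2, h3⟩ := (hA' _).1 hp
      obtain rfl : t = 0 := h3
      rw [wedgeRescale_bottom]
      exact ⟨h1, h2, rfl⟩
    · obtain ⟨x, t⟩ := p
      rintro ⟨h1, h2, h3⟩
      obtain rfl : t = 0 := h3
      exact ⟨(x, 0), (hA' _).2 ⟨h1, h2, rfl⟩, wedgeRescale_bottom x⟩
  · refine mk m 0 fun p => ?_
    rw [mem_maximizers_geomWedge_of_zero hd m]
    rw [hzero] at hA'
    simp only [mem_maximizers_geomWedge_of_zero hc m] at hA'
    constructor
    · rintro ⟨q, hq, rfl⟩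
      obtain ⟨h1, h2⟩ := (hA' _).1 hq
      exact ⟨wedgeRescale_mem hc hd h1, h2⟩
    · rintro ⟨h1, h2⟩
      exact ⟨wedgeRescale d ε c δ p, (hA' _).2 ⟨wedgeRescale_mem hd hc h1, h2⟩,
        wedgeRescale_wedgeRescale h0' h1⟩
  -- On the new top the height is `ε - d x`, so with last coefficient 1 the summand `d` cancels and,
  -- up to a constant, `m - a • c` remains: what the old functional maximizes on the old top.
  · refine mk (m - a • c + d) 1 fun p => ?_
    rw [mem_maximizers_geomWedge_of_pos hd _ one_pos]
    simp only [mem_maximizers_geomWedge_of_pos hc m hpos] at hA'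
    constructor
    · rintro ⟨⟨x, t⟩, hp, rfl⟩
      obtain ⟨h1, h2, h3⟩ := (hA' _).1 hp
      obtain rfl : t = δ - c x := h3
      rw [wedgeRescale_top h0 h1]
      exact ⟨h1, fun y hy => by simpa using h2 y hy, rfl⟩
    · obtain ⟨x, t⟩ := p
      rintro ⟨h1, h2, h3⟩
      obtain rfl : t = ε - d x := h3
      exact ⟨(x, δ - c x), (hA' _).2 ⟨h1, fun y hy => by simpa using h2 y hy, rfl⟩,
        wedgeRescale_top h0 h1⟩

/-- The combinatorial type of a wedge does not depend on the inequality defining the face. -/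
theorem combEquiv_geomWedge [IsTopologicalAddGroup E] [ContinuousSMul ℝ E] {F : Set E}
    (hc : DefinesFace Q F c δ) (hd : DefinesFace Q F d ε) :
    CombEquiv (geomWedge Q c δ) (geomWedge Q d ε) := by
  have h0 : ∀ x ∈ Q, c x = δ ↔ d x = ε := fun x hx => by
    have h := Set.ext_iff.1 (hc.2.symm.trans hd.2) x
    simpa [hx] using h
  have h0' : ∀ x ∈ Q, d x = ε ↔ c x = δ := fun x hx => (h0 x hx).symm
  exact CombEquiv.of_invOn (wedgeRescale c δ d ε) (wedgeRescale d ε c δ)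
    (fun _ hp => wedgeRescale_wedgeRescale h0 hp) (fun _ hp => wedgeRescale_wedgeRescale h0' hp)
    (fun _ hA => hA.image_wedgeRescale hc.1 hd.1 h0)
    (fun _ hA => hA.image_wedgeRescale hd.1 hc.1 h0')

end Rescale

end Polytopes

/-! ### Faces of convex hulls -/

/-- The face of a convex hull defined by a valid inequality is spanned by the generators that
attain equality. -/
theorem convexHull_inter_eq_of_le {E : Type*} [AddCommGroup E] [Module ℝ E] {s : Set E} {l : E →ₗ[ℝ] ℝ}
    {δ : ℝ} (h : ∀ x ∈ s, l x ≤ δ) :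
    {x ∈ convexHull ℝ s | l x = δ} = convexHull ℝ {x ∈ s | l x = δ} := by
  apply Set.Subset.antisymm
  -- The implication alone need not survive convex combinations. Together with `l x ≤ δ` it does:
  -- equality at a combination with positive weights forces equality at both points.
  · have hconv : Convex ℝ {x | l x ≤ δ ∧ (l x = δ → x ∈ convexHull ℝ {x ∈ s | l x = δ})} := by
      rw [convex_iff_forall_pos]
      rintro x ⟨hx, hx'⟩ y ⟨hy, hy'⟩ a b ha hb hab
      have hδ : δ = a * δ + b * δ := by rw [← add_mul, hab, one_mul]
      have h1 := mul_le_mul_of_nonneg_left hx ha.le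
      have h2 := mul_le_mul_of_nonneg_left hy hb.le
      refine ⟨?_, fun heq => ?_⟩
      · simp only [map_add, map_smul, smul_eq_mul]
        linarith
      · simp only [map_add, map_smul, smul_eq_mul] at heq
        have e1 : l x = δ := mul_left_cancel₀ ha.ne' (by linarith)
        have e2 : l y = δ := mul_left_cancel₀ hb.ne' (by linarith)
        exact convex_convexHull ℝ _ (hx' e1) (hy' e2) ha.le hb.le hab
    rintro x ⟨hx, hlx⟩
    have hsub : s ⊆ {x | l x ≤ δ ∧ (l x = δ → x ∈ convexHull ℝ {x ∈ s | l x = δ})} :=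
      fun y hy => ⟨h y hy, fun e => subset_convexHull ℝ _ ⟨hy, e⟩⟩
    exact (convexHull_min hsub hconv hx).2 hlx
  · intro x hx
    refine ⟨convexHull_mono (fun y hy => hy.1) hx, ?_⟩
    have hconv : Convex ℝ {x | l x = δ} := convex_hyperplane l.isLinear δ
    exact convexHull_min (fun y hy => hy.2) hconv hx

/-! ### Perfect matchings as permutations, and faces of the Birkhoff polytope -/

section Matchings

variable {n : ℕ} {G : SimpleGraph (Fin n ⊕ Fin n)}

/-- The permutation `σ` describes a perfect matching of the bipartite graph `G`. -/
def IsAdapted (G : SimpleGraph (Fin n ⊕ Fin n)) (σ : Equiv.Perm (Fin n)) : Prop :=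
  ∀ i, G.Adj (Sum.inl i) (Sum.inr (σ i))

/-- The perfect matching described by a permutation. -/
def IsAdapted.matching {σ : Equiv.Perm (Fin n)} (h : IsAdapted G σ) : G.Subgraph where
  verts := Set.univ
  Adj a b := ∃ i, (a = Sum.inl i ∧ b = Sum.inr (σ i)) ∨ (b = Sum.inl i ∧ a = Sum.inr (σ i))
  adj_sub := by
    rintro a b ⟨i, ⟨rfl, rfl⟩ | ⟨rfl, rfl⟩⟩
    · exact h i
    · exact (h i).symm
  edge_vert _ := Set.mem_univ _
  symm := ⟨by
    rintro a b ⟨i, h⟩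
    exact ⟨i, h.symm⟩⟩

theorem IsAdapted.matching_adj {σ : Equiv.Perm (Fin n)} (h : IsAdapted G σ) (i j : Fin n) :
    h.matching.Adj (Sum.inl i) (Sum.inr j) ↔ σ i = j := by
  simp [IsAdapted.matching, eq_comm]

theorem IsAdapted.isPerfectMatching {σ : Equiv.Perm (Fin n)} (h : IsAdapted G σ) :
    h.matching.IsPerfectMatching := by
  rw [SimpleGraph.Subgraph.isPerfectMatching_iff]
  rintro (i | j)
  · refine ⟨Sum.inr (σ i), (h.matching_adj _ _).2 rfl, ?_⟩
    rintro (k | k) hk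
    · simp [IsAdapted.matching] at hk
    · rw [h.matching_adj] at hk; rw [hk]
  · refine ⟨Sum.inl (σ.symm j), ((h.matching_adj _ _).2 (σ.apply_symm_apply j)).symm, ?_⟩
    rintro (k | k) hk
    · have := (h.matching_adj _ _).1 hk.symm
      simp [← this]
    · simp [IsAdapted.matching] at hk

/-- A perfect matching of a bipartite graph is described by a permutation. -/
theorem exists_isAdapted_of_isPerfectMatching
    (hG : G.IsBipartiteWith (Set.range Sum.inl) (Set.range Sum.inr)) {M : G.Subgraph}
    (hM : M.IsPerfectMatching) :
    ∃ σ, IsAdapted G σ ∧ ∀ i j, M.Adj (Sum.inl i) (Sum.inr j) ↔ σ i = j := by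
  rw [SimpleGraph.Subgraph.isPerfectMatching_iff] at hM
  have hex : ∀ i, ∃ j, M.Adj (Sum.inl i) (Sum.inr j) := by
    intro i
    obtain ⟨b, hb, -⟩ := hM (Sum.inl i)
    rcases b with k | k
    · have := hG.mem_of_adj (M.adj_sub hb)
      simp at this
    · exact ⟨k, hb⟩
  choose s hs using hex
  -- A lower node has only one partner in `M`.
  have hinj : Function.Injective s := by
    intro i k hik
    have h1 := (hs i).symm
    rw [hik] at h1
    exact Sum.inl_injective ((hM (Sum.inr (s k))).unique h1 (hs k).symm)
  refine ⟨Equiv.ofBijective s (Finite.injective_iff_bijective.1 hinj),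
    fun i => M.adj_sub (hs i), fun i j => ⟨fun h => ?_, ?_⟩⟩
  · exact Sum.inr_injective ((hM (Sum.inl i)).unique (hs i) h)
  · rintro rfl
    exact hs i

theorem matchingMatrix_eq_permMatrix {M : G.Subgraph} {σ : Equiv.Perm (Fin n)}
    (h : ∀ i j, M.Adj (Sum.inl i) (Sum.inr j) ↔ σ i = j) :
    matchingMatrix M = σ.permMatrix ℝ := by
  ext i j
  simp [matchingMatrix, h, Equiv.Perm.permMatrix, PEquiv.toMatrix_apply, eq_comm]

theorem permMatrix_apply' (σ : Equiv.Perm (Fin n)) (i j : Fin n) :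
    σ.permMatrix ℝ i j = if σ i = j then 1 else 0 := by
  simp [Equiv.Perm.permMatrix, PEquiv.toMatrix_apply, eq_comm]

theorem graphFace_eq (hG : G.IsBipartiteWith (Set.range Sum.inl) (Set.range Sum.inr)) :
    graphFace G = convexHull ℝ {x | ∃ σ, IsAdapted G σ ∧ x = σ.permMatrix ℝ} := by
  unfold graphFace
  congr 1
  ext x
  constructor
  · rintro ⟨M, hM, rfl⟩
    obtain ⟨σ, hσ, h⟩ := exists_isAdapted_of_isPerfectMatching hG hM
    exact ⟨σ, hσ, matchingMatrix_eq_permMatrix h⟩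
  · rintro ⟨σ, hσ, rfl⟩
    exact ⟨hσ.matching, hσ.isPerfectMatching, (matchingMatrix_eq_permMatrix hσ.matching_adj).symm⟩

theorem avoidingFace_eq (hG : G.IsBipartiteWith (Set.range Sum.inl) (Set.range Sum.inr))
    (u v : Fin n) : avoidingFace G s(Sum.inl u, Sum.inr v) =
      convexHull ℝ {x | ∃ σ, IsAdapted G σ ∧ σ u ≠ v ∧ x = σ.permMatrix ℝ} := by
  unfold avoidingFace
  congr 1
  ext x
  simp only [SimpleGraph.Subgraph.mem_edgeSet]
  constructor
  · rintro ⟨M, hM, hM', rfl⟩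
    obtain ⟨σ, hσ, h⟩ := exists_isAdapted_of_isPerfectMatching hG hM
    exact ⟨σ, hσ, fun h' => hM' ((h u v).2 h'), matchingMatrix_eq_permMatrix h⟩
  · rintro ⟨σ, hσ, h, rfl⟩
    exact ⟨hσ.matching, hσ.isPerfectMatching, fun h' => h ((hσ.matching_adj u v).1 h'),
      (matchingMatrix_eq_permMatrix hσ.matching_adj).symm⟩

theorem isFaceGraph_iff : IsFaceGraph G ↔
    G.IsBipartiteWith (Set.range Sum.inl) (Set.range Sum.inr) ∧
      ∀ i j, G.Adj (Sum.inl i) (Sum.inr j) → ∃ σ, IsAdapted G σ ∧ σ i = j := by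
  refine and_congr_right fun hG => ⟨fun h i j hij => ?_, fun h e he => ?_⟩
  · obtain ⟨M, hM, he⟩ := h s(Sum.inl i, Sum.inr j) hij
    obtain ⟨σ, hσ, hσM⟩ := exists_isAdapted_of_isPerfectMatching hG hM
    exact ⟨σ, hσ, (hσM i j).1 he⟩
  · have main : ∀ i j, G.Adj (Sum.inl i) (Sum.inr j) →
        ∃ M : G.Subgraph, M.IsPerfectMatching ∧ M.Adj (Sum.inl i) (Sum.inr j) := by
      intro i j hij
      obtain ⟨σ, hσ, rfl⟩ := h i j hij
      exact ⟨hσ.matching, hσ.isPerfectMatching, (hσ.matching_adj _ _).2 rfl⟩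
    induction e with
    | _ a b =>
      have hab : G.Adj a b := he
      rcases hG.mem_of_adj hab with ⟨⟨i, rfl⟩, ⟨j, rfl⟩⟩ | ⟨⟨j, rfl⟩, ⟨i, rfl⟩⟩
      · exact main i j hab
      · obtain ⟨M, hM, hadj⟩ := main i j hab.symm
        exact ⟨M, hM, hadj.symm⟩

/-- Minus the sum of the entries at the non-edges of `G`. -/
noncomputable def nonEdgeFunctional (G : SimpleGraph (Fin n ⊕ Fin n)) :
    Matrix (Fin n) (Fin n) ℝ →ₗ[ℝ] ℝ :=
  open Classical in
  -∑ i, ∑ j, if G.Adj (Sum.inl i) (Sum.inr j) then 0 else Matrix.entryLinearMap ℝ ℝ i j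

/-- On a permutation matrix the functional is minus the number of non-edges that `σ` uses. -/
theorem nonEdgeFunctional_permMatrix_le (σ : Equiv.Perm (Fin n)) :
    nonEdgeFunctional G (σ.permMatrix ℝ) ≤ 0 ∧
      (nonEdgeFunctional G (σ.permMatrix ℝ) = 0 ↔ IsAdapted G σ) := by
  classical
  have h : nonEdgeFunctional G (σ.permMatrix ℝ) =
      -∑ i, if G.Adj (Sum.inl i) (Sum.inr (σ i)) then (0 : ℝ) else 1 := by
    simp only [nonEdgeFunctional, LinearMap.neg_apply, LinearMap.sum_apply]
    congr 1
    refine Finset.sum_congr rfl fun i _ => ?_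
    rw [Finset.sum_eq_single (σ i)]
    · split_ifs <;> simp
    · intro j _ hj
      split_ifs <;> simp [hj.symm]
    · simp
  have hnn : ∀ i ∈ Finset.univ,
      (0 : ℝ) ≤ if G.Adj (Sum.inl i) (Sum.inr (σ i)) then (0 : ℝ) else 1 := by
    intro i _
    split_ifs <;> norm_num
  rw [h]
  refine ⟨neg_nonpos.2 (Finset.sum_nonneg hnn), ?_⟩
  rw [neg_eq_zero, Finset.sum_eq_zero_iff_of_nonneg hnn]
  simp [IsAdapted]

/-- The polytope of a bipartite graph is a face of the Birkhoff polytope. -/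
theorem isExposed_birkhoffPolytope_graphFace
    (hG : G.IsBipartiteWith (Set.range Sum.inl) (Set.range Sum.inr)) :
    IsExposed ℝ (birkhoffPolytope n) (graphFace G) := by
  have hle : ∀ x ∈ Set.range (fun σ : Equiv.Perm (Fin n) => σ.permMatrix ℝ),
      nonEdgeFunctional G x ≤ 0 := by
    rintro _ ⟨σ, rfl⟩
    exact (nonEdgeFunctional_permMatrix_le σ).1
  have hface : graphFace G = {x ∈ birkhoffPolytope n | nonEdgeFunctional G x = 0} := by
    rw [birkhoffPolytope, convexHull_inter_eq_of_le hle, graphFace_eq hG]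
    congr 1
    ext x
    constructor
    · rintro ⟨σ, hσ, rfl⟩
      exact ⟨⟨σ, rfl⟩, (nonEdgeFunctional_permMatrix_le σ).2.2 hσ⟩
    · rintro ⟨⟨σ, rfl⟩, h⟩
      exact ⟨σ, (nonEdgeFunctional_permMatrix_le σ).2.1 h, rfl⟩
  have hvalid : ∀ x ∈ birkhoffPolytope n, nonEdgeFunctional G x ≤ 0 := fun x hx =>
    convexHull_min hle (convex_halfSpace_le (nonEdgeFunctional G).isLinear 0) hx
  -- Nonemptiness is what makes 0 the attained maximum, so that tightness and maximality agree.
  rintro ⟨x₀, hx₀⟩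
  refine ⟨LinearMap.toContinuousLinearMap (nonEdgeFunctional G), ?_⟩
  rw [hface] at hx₀ ⊢
  ext x
  simp only [Set.mem_ofPred_eq, LinearMap.coe_toContinuousLinearMap']
  refine and_congr_right fun hx => ⟨fun h y hy => h ▸ hvalid y hy, fun h => ?_⟩
  exact le_antisymm (hvalid x hx) (hx₀.2 ▸ h x₀ hx₀.1)

end Matchings

/-! ### Perfect matchings of the graph with the attached path -/

section AttachPath

variable {n : ℕ} {G : SimpleGraph (Fin n ⊕ Fin n)} {u v : Fin n}

theorem attachPath_adj_castSucc_castSucc (i j : Fin n) :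
    (attachPath G u v).Adj (Sum.inl i.castSucc) (Sum.inr j.castSucc) ↔
      G.Adj (Sum.inl i) (Sum.inr j) := by
  simp [attachPath, SimpleGraph.map_adj', SimpleGraph.edge_adj, (Fin.castSucc_lt_last _).ne]

theorem attachPath_adj_castSucc_last (i : Fin n) :
    (attachPath G u v).Adj (Sum.inl i.castSucc) (Sum.inr (Fin.last n)) ↔ i = u := by
  simp [attachPath, SimpleGraph.map_adj', SimpleGraph.edge_adj, (Fin.castSucc_lt_last _).ne]

theorem attachPath_adj_last_castSucc (j : Fin n) :
    (attachPath G u v).Adj (Sum.inl (Fin.last n)) (Sum.inr j.castSucc) ↔ j = v := by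
  simp [attachPath, SimpleGraph.map_adj', SimpleGraph.edge_adj, (Fin.castSucc_lt_last _).ne]

theorem attachPath_adj_last_last :
    (attachPath G u v).Adj (Sum.inl (Fin.last n)) (Sum.inr (Fin.last n)) := by
  simp [attachPath, SimpleGraph.edge_adj]

theorem attachPath_isBipartiteWith
    (hG : G.IsBipartiteWith (Set.range Sum.inl) (Set.range Sum.inr)) :
    (attachPath G u v).IsBipartiteWith (Set.range Sum.inl) (Set.range Sum.inr) := by
  refine ⟨Set.isCompl_range_inl_range_inr.disjoint, ?_⟩
  intro a b hab
  simp only [attachPath, SimpleGraph.sup_adj, SimpleGraph.map_adj, SimpleGraph.edge_adj] at hab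
  rcases hab with ((⟨a', b', h, rfl, rfl⟩ | h) | h) | h
  · rcases hG.mem_of_adj h with ⟨⟨i, rfl⟩, ⟨j, rfl⟩⟩ | ⟨⟨j, rfl⟩, ⟨i, rfl⟩⟩ <;> simp
  all_goals
    obtain ⟨⟨rfl, rfl⟩ | ⟨rfl, rfl⟩, -⟩ := h <;> simp

/-- The extension of a permutation by a fixed point. -/
def extendPerm (σ : Equiv.Perm (Fin n)) : Equiv.Perm (Fin (n + 1)) :=
  (finSuccEquivLast.trans σ.optionCongr).trans finSuccEquivLast.symm

@[simp] theorem extendPerm_castSucc (σ : Equiv.Perm (Fin n)) (i : Fin n) :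
    extendPerm σ i.castSucc = (σ i).castSucc := by
  simp [extendPerm]

@[simp] theorem extendPerm_last (σ : Equiv.Perm (Fin n)) :
    extendPerm σ (Fin.last n) = Fin.last n := by
  simp [extendPerm]

theorem exists_extendPerm_eq {τ : Equiv.Perm (Fin (n + 1))} (h : τ (Fin.last n) = Fin.last n) :
    ∃ σ, extendPerm σ = τ := by
  have hex : ∀ i : Fin n, ∃ j : Fin n, j.castSucc = τ i.castSucc := by
    intro i
    refine Fin.exists_castSucc_eq.2 fun hi => ?_
    exact (Fin.castSucc_lt_last i).ne (τ.injective (hi.trans h.symm))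
  choose s hs using hex
  have hinj : Function.Injective s := fun i k hik =>
    Fin.castSucc_injective n (τ.injective (by rw [← hs, ← hs, hik]))
  refine ⟨Equiv.ofBijective s (Finite.injective_iff_bijective.1 hinj), Equiv.ext fun i => ?_⟩
  induction i using Fin.lastCases with
  | last => simp [h]
  | cast i => simp [hs]

theorem isAdapted_extendPerm {σ : Equiv.Perm (Fin n)} :
    IsAdapted (attachPath G u v) (extendPerm σ) ↔ IsAdapted G σ := by
  constructor
  · intro h i
    have := h i.castSucc
    rwa [extendPerm_castSucc, attachPath_adj_castSucc_castSucc] at this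
  · intro h i
    induction i using Fin.lastCases with
    | last => rw [extendPerm_last]; exact attachPath_adj_last_last
    | cast i => rw [extendPerm_castSucc, attachPath_adj_castSucc_castSucc]; exact h i

/-- The rerouting of the extension of a permutation `σ` along the attached path at `u`. -/
def reroutePerm (u : Fin n) (σ : Equiv.Perm (Fin n)) : Equiv.Perm (Fin (n + 1)) :=
  -- The swap acts first: `u` goes to `v'`, and `u'` takes over the old partner of `u`.
  extendPerm σ * Equiv.swap u.castSucc (Fin.last n)

theorem reroutePerm_self (σ : Equiv.Perm (Fin n)) :
    reroutePerm u σ u.castSucc = Fin.last n := by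
  simp [reroutePerm]

theorem reroutePerm_last (σ : Equiv.Perm (Fin n)) :
    reroutePerm u σ (Fin.last n) = (σ u).castSucc := by
  simp [reroutePerm]

theorem reroutePerm_of_ne (σ : Equiv.Perm (Fin n)) {i : Fin n} (hi : i ≠ u) :
    reroutePerm u σ i.castSucc = (σ i).castSucc := by
  have h1 : i.castSucc ≠ u.castSucc := fun h => hi (Fin.castSucc_injective n h)
  simp [reroutePerm, Equiv.swap_apply_of_ne_of_ne h1 (Fin.castSucc_lt_last i).ne]

/-- The only old neighbour of `u'` is `v`, which forces `σ u = v`. The rerouted permutation does not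
use the edge at `u` itself, so that edge has to come from `huv`. -/
theorem isAdapted_reroutePerm (huv : G.Adj (Sum.inl u) (Sum.inr v)) {σ : Equiv.Perm (Fin n)} :
    IsAdapted (attachPath G u v) (reroutePerm u σ) ↔ IsAdapted G σ ∧ σ u = v := by
  constructor
  · intro h
    have hu : σ u = v := by
      have := h (Fin.last n)
      rwa [reroutePerm_last, attachPath_adj_last_castSucc] at this
    refine ⟨fun i => ?_, hu⟩
    rcases eq_or_ne i u with rfl | hi
    · rwa [hu]
    · have := h i.castSucc
      rwa [reroutePerm_of_ne σ hi, attachPath_adj_castSucc_castSucc] at this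
  · rintro ⟨h, hu⟩ i
    induction i using Fin.lastCases with
    | last => rw [reroutePerm_last, attachPath_adj_last_castSucc]; exact hu
    | cast i =>
      rcases eq_or_ne i u with rfl | hi
      · rw [reroutePerm_self, attachPath_adj_castSucc_last]
      · rw [reroutePerm_of_ne σ hi, attachPath_adj_castSucc_castSucc]; exact h i

/-- Every perfect matching of the graph with the attached path extends or reroutes one of `G`. -/
theorem isAdapted_attachPath_iff (huv : G.Adj (Sum.inl u) (Sum.inr v))
    {τ : Equiv.Perm (Fin (n + 1))} :
    IsAdapted (attachPath G u v) τ ↔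
      (∃ σ, IsAdapted G σ ∧ τ = extendPerm σ) ∨
        ∃ σ, IsAdapted G σ ∧ σ u = v ∧ τ = reroutePerm u σ := by
  constructor
  · intro h
    by_cases hl : τ (Fin.last n) = Fin.last n
    · obtain ⟨σ, rfl⟩ := exists_extendPerm_eq hl
      exact Or.inl ⟨σ, isAdapted_extendPerm.1 h, rfl⟩
    -- The partner of `v'` is not `u'`, and its only other neighbour is `u`. Undoing the swap then
    -- gives a permutation fixing the last index.
    · have hu : τ u.castSucc = Fin.last n := by
        have h1 := h (τ.symm (Fin.last n))
        rw [Equiv.apply_symm_apply] at h1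
        have h2 : τ.symm (Fin.last n) ≠ Fin.last n := fun h' =>
          hl ((Equiv.symm_apply_eq τ).1 h').symm
        obtain ⟨i, hi⟩ := Fin.exists_castSucc_eq.2 h2
        rw [← hi, attachPath_adj_castSucc_last] at h1
        rw [← h1, hi, Equiv.apply_symm_apply]
      obtain ⟨σ, hσ⟩ := exists_extendPerm_eq
        (τ := τ * Equiv.swap u.castSucc (Fin.last n)) (by simp [hu])
      have hτ : τ = reroutePerm u σ := by
        rw [reroutePerm, hσ, mul_assoc, Equiv.swap_mul_self, mul_one]
      rw [hτ, isAdapted_reroutePerm huv] at h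
      exact Or.inr ⟨σ, h.1, h.2, hτ⟩
  · rintro (⟨σ, h, rfl⟩ | ⟨σ, h, hu, rfl⟩)
    · exact isAdapted_extendPerm.2 h
    · exact (isAdapted_reroutePerm huv).2 ⟨h, hu⟩

theorem IsFaceGraph.attachPath (hG : IsFaceGraph G) (huv : G.Adj (Sum.inl u) (Sum.inr v)) :
    IsFaceGraph (attachPath G u v) := by
  obtain ⟨hb, h⟩ := isFaceGraph_iff.1 hG
  obtain ⟨σ₀, hσ₀, hu⟩ := h u v huv
  refine isFaceGraph_iff.2 ⟨attachPath_isBipartiteWith hb, fun i j hij => ?_⟩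
  induction i using Fin.lastCases with
  | last =>
    induction j using Fin.lastCases with
    | last => exact ⟨extendPerm σ₀, isAdapted_extendPerm.2 hσ₀, extendPerm_last _⟩
    | cast j =>
      rw [attachPath_adj_last_castSucc] at hij
      refine ⟨reroutePerm u σ₀, (isAdapted_reroutePerm huv).2 ⟨hσ₀, hu⟩, ?_⟩
      rw [reroutePerm_last, hu, hij]
  | cast i =>
    induction j using Fin.lastCases with
    | last =>
      rw [attachPath_adj_castSucc_last] at hij
      refine ⟨reroutePerm u σ₀, (isAdapted_reroutePerm huv).2 ⟨hσ₀, hu⟩, ?_⟩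
      rw [hij, reroutePerm_self]
    | cast j =>
      rw [attachPath_adj_castSucc_castSucc] at hij
      obtain ⟨σ, hσ, rfl⟩ := h i j hij
      exact ⟨extendPerm σ, isAdapted_extendPerm.2 hσ, extendPerm_castSucc _ _⟩

/-! ### The affine isomorphism with the wedge -/

/-- The linear part of the map sending a point of the wedge to a point of the polytope of the graph
with the attached path: the amount `t` is moved from the edge `uv` to the path. -/
def rerouteLinear (u v : Fin n) :
    Matrix (Fin n) (Fin n) ℝ × ℝ →ₗ[ℝ] Matrix (Fin (n + 1)) (Fin (n + 1)) ℝ where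
  toFun p := Matrix.of fun i j =>
    Fin.lastCases (Fin.lastCases (-p.2) (fun j => if j = v then p.2 else 0) j)
      (fun i => Fin.lastCases (if i = u then p.2 else 0)
        (fun j => p.1 i j - if i = u ∧ j = v then p.2 else 0) j) i
  map_add' p q := by
    ext i j
    induction i using Fin.lastCases <;> induction j using Fin.lastCases <;>
      simp only [Matrix.of_apply, Matrix.add_apply, Fin.lastCases_last, Fin.lastCases_castSucc,
        Prod.fst_add, Prod.snd_add] <;>
      (try split_ifs) <;> ring
  map_smul' a p := by
    ext i j
    induction i using Fin.lastCases <;> induction j using Fin.lastCases <;>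
      simp only [Matrix.of_apply, Matrix.smul_apply, Fin.lastCases_last, Fin.lastCases_castSucc,
        Prod.smul_fst, Prod.smul_snd, smul_eq_mul, RingHom.id_apply] <;>
      (try split_ifs) <;> ring

/-- The affine map sending a point of the wedge to a point of the polytope of the graph with the
attached path. -/
def rerouteMap (u v : Fin n) (p : Matrix (Fin n) (Fin n) ℝ × ℝ) :
    Matrix (Fin (n + 1)) (Fin (n + 1)) ℝ :=
  -- The constant is the edge `u'v'`, which has full weight at height 0; at height t its weight is 1
  -- - t.
  rerouteLinear u v p + Matrix.single (Fin.last n) (Fin.last n) 1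

theorem rerouteMap_last_last (p : Matrix (Fin n) (Fin n) ℝ × ℝ) :
    rerouteMap u v p (Fin.last n) (Fin.last n) = 1 - p.2 := by
  simp [rerouteMap, rerouteLinear]
  ring

theorem rerouteMap_last_castSucc (p : Matrix (Fin n) (Fin n) ℝ × ℝ) (j : Fin n) :
    rerouteMap u v p (Fin.last n) j.castSucc = if j = v then p.2 else 0 := by
  simp [rerouteMap, rerouteLinear, (Fin.castSucc_lt_last _).ne']

theorem rerouteMap_castSucc_last (p : Matrix (Fin n) (Fin n) ℝ × ℝ) (i : Fin n) :
    rerouteMap u v p i.castSucc (Fin.last n) = if i = u then p.2 else 0 := by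
  simp [rerouteMap, rerouteLinear, (Fin.castSucc_lt_last _).ne']

theorem rerouteMap_castSucc_castSucc (p : Matrix (Fin n) (Fin n) ℝ × ℝ) (i j : Fin n) :
    rerouteMap u v p i.castSucc j.castSucc = p.1 i j - if i = u ∧ j = v then p.2 else 0 := by
  simp [(Fin.castSucc_lt_last _).ne', rerouteMap, rerouteLinear]

/-- The inverse of `rerouteMap`: the path is contracted to the edge `uv`. -/
def contractMap (u v : Fin n) :
    Matrix (Fin (n + 1)) (Fin (n + 1)) ℝ →ₗ[ℝ] Matrix (Fin n) (Fin n) ℝ × ℝ where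
  toFun y := (Matrix.of fun i j => y i.castSucc j.castSucc +
    if i = u ∧ j = v then y u.castSucc (Fin.last n) else 0, y u.castSucc (Fin.last n))
  map_add' y z := by
    ext i j
    · simp only [Matrix.add_apply, Matrix.of_apply, Prod.fst_add]
      split_ifs <;> ring
    · simp
  map_smul' a y := by
    ext i j
    · simp [mul_add]
    · simp

theorem contractMap_rerouteMap (p : Matrix (Fin n) (Fin n) ℝ × ℝ) :
    contractMap u v (rerouteMap u v p) = p := by
  ext i j
  · simp [contractMap, rerouteMap_castSucc_castSucc, rerouteMap_castSucc_last]
  · simp [contractMap, rerouteMap_castSucc_last]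

theorem rerouteMap_convexComb (p q : Matrix (Fin n) (Fin n) ℝ × ℝ) {a b : ℝ} (hab : a + b = 1) :
    rerouteMap u v (a • p + b • q) = a • rerouteMap u v p + b • rerouteMap u v q := by
  have h : Matrix.single (Fin.last n) (Fin.last n) (1 : ℝ) =
      a • Matrix.single (Fin.last n) (Fin.last n) 1 +
        b • Matrix.single (Fin.last n) (Fin.last n) 1 := by
    rw [← add_smul, hab, one_smul]
  simp only [rerouteMap, map_add, map_smul, smul_add]
  nth_rewrite 1 [h]
  abel

theorem rerouteMap_permMatrix_zero (σ : Equiv.Perm (Fin n)) :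
    rerouteMap u v (σ.permMatrix ℝ, 0) = (extendPerm σ).permMatrix ℝ := by
  ext i j
  induction i using Fin.lastCases <;> induction j using Fin.lastCases <;>
    simp [rerouteMap_last_last,
      rerouteMap_last_castSucc, rerouteMap_castSucc_last, rerouteMap_castSucc_castSucc,
      (Fin.castSucc_lt_last _).ne, (Fin.castSucc_lt_last _).ne']

theorem rerouteMap_permMatrix_one {σ : Equiv.Perm (Fin n)} (hσ : σ u = v) :
    rerouteMap u v (σ.permMatrix ℝ, 1) = (reroutePerm u σ).permMatrix ℝ := by
  subst hσ
  ext i j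
  rw [permMatrix_apply']
  induction i using Fin.lastCases with
  | last =>
    rw [reroutePerm_last]
    induction j using Fin.lastCases with
    | last => simp [rerouteMap_last_last, (Fin.castSucc_lt_last _).ne]
    | cast j => simp [rerouteMap_last_castSucc, eq_comm]
  | cast i =>
    rcases eq_or_ne i u with rfl | hi
    · rw [reroutePerm_self]
      induction j using Fin.lastCases with
      | last => simp [rerouteMap_castSucc_last]
      | cast j =>
        rw [rerouteMap_castSucc_castSucc]
        simp [eq_comm, (Fin.castSucc_lt_last _).ne]
    · rw [reroutePerm_of_ne σ hi]
      induction j using Fin.lastCases with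
      | last => simp [rerouteMap_castSucc_last, hi, (Fin.castSucc_lt_last _).ne]
      | cast j =>
        rw [rerouteMap_castSucc_castSucc]
        simp [hi]

/-- The functional `x ↦ -x u v`. -/
noncomputable def negEntry (u v : Fin n) : Matrix (Fin n) (Fin n) ℝ →L[ℝ] ℝ :=
  LinearMap.toContinuousLinearMap (-Matrix.entryLinearMap ℝ ℝ u v)

theorem negEntry_apply (x : Matrix (Fin n) (Fin n) ℝ) : negEntry u v x = -x u v := rfl

theorem graphFace_entry_nonneg (hG : G.IsBipartiteWith (Set.range Sum.inl) (Set.range Sum.inr))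
    {x : Matrix (Fin n) (Fin n) ℝ} (hx : x ∈ graphFace G) : 0 ≤ x u v := by
  rw [graphFace_eq hG] at hx
  have hconv : Convex ℝ {x : Matrix (Fin n) (Fin n) ℝ | 0 ≤ x u v} :=
    convex_halfSpace_ge (Matrix.entryLinearMap ℝ ℝ u v).isLinear 0
  refine convexHull_min ?_ hconv hx
  rintro _ ⟨σ, -, rfl⟩
  simp only [Set.mem_ofPred_eq, permMatrix_apply']
  split_ifs <;> norm_num

/-- The perfect matchings avoiding `uv` span the face defined by `x u v ≥ 0`. -/
theorem definesFace_avoidingFace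
    (hG : G.IsBipartiteWith (Set.range Sum.inl) (Set.range Sum.inr)) :
    DefinesFace (graphFace G) (avoidingFace G s(Sum.inl u, Sum.inr v)) (negEntry u v) 0 := by
  refine ⟨fun x hx => ?_, ?_⟩
  · rw [negEntry_apply]
    linarith [graphFace_entry_nonneg (u := u) (v := v) hG hx]
  · have hle : ∀ x ∈ {x | ∃ σ, IsAdapted G σ ∧ x = σ.permMatrix ℝ},
        (negEntry u v).toLinearMap x ≤ 0 := by
      intro x hx
      have := graphFace_entry_nonneg (u := u) (v := v) hG
        (by rw [graphFace_eq hG]; exact subset_convexHull ℝ _ hx)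
      simpa [negEntry_apply] using this
    have := convexHull_inter_eq_of_le hle
    rw [avoidingFace_eq hG, graphFace_eq hG]
    refine Eq.trans ?_ this.symm
    congr 1
    ext x
    constructor
    · rintro ⟨σ, hσ, h, rfl⟩
      refine ⟨⟨σ, hσ, rfl⟩, ?_⟩
      change -(σ.permMatrix ℝ u v) = 0
      simp [h]
    · rintro ⟨⟨σ, hσ, rfl⟩, h⟩
      refine ⟨σ, hσ, fun h' => ?_, rfl⟩
      change -(σ.permMatrix ℝ u v) = 0 at h
      rw [permMatrix_apply', if_pos h'] at h
      norm_num at h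

/-- Membership is checked on the bottom and the top, where it reduces to permutation matrices
because both are affine images of the base. A point between them is a convex combination of the two
ends of its fibre. -/
theorem rerouteMap_mem_graphFace
    (hG : G.IsBipartiteWith (Set.range Sum.inl) (Set.range Sum.inr))
    (huv : G.Adj (Sum.inl u) (Sum.inr v)) {p : Matrix (Fin n) (Fin n) ℝ × ℝ}
    (hp : p ∈ geomWedge (graphFace G) (negEntry u v) 0) :
    rerouteMap u v p ∈ graphFace (attachPath G u v) := by
  have hG' := attachPath_isBipartiteWith (u := u) (v := v) hG
  have hmem : ∀ τ, IsAdapted (attachPath G u v) τ →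
      τ.permMatrix ℝ ∈ graphFace (attachPath G u v) := fun τ hτ => by
    rw [graphFace_eq hG']
    exact subset_convexHull ℝ _ ⟨τ, hτ, rfl⟩
  have hconv : Convex ℝ (graphFace (attachPath G u v)) := convex_convexHull ℝ _
  have bottom : ∀ x ∈ graphFace G, rerouteMap u v (x, 0) ∈ graphFace (attachPath G u v) := by
    intro x hx
    rw [graphFace_eq hG] at hx
    have hc : Convex ℝ {x | rerouteMap u v (x, 0) ∈ graphFace (attachPath G u v)} := by
      intro x hx y hy a b ha hb hab
      have := hconv hx hy ha hb hab
      rw [← rerouteMap_convexComb _ _ hab] at this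
      simpa using this
    refine convexHull_min ?_ hc hx
    rintro _ ⟨σ, hσ, rfl⟩
    simp only [Set.mem_ofPred_eq, rerouteMap_permMatrix_zero]
    exact hmem _ (isAdapted_extendPerm.2 hσ)
  have top : ∀ x ∈ graphFace G, rerouteMap u v (x, x u v) ∈ graphFace (attachPath G u v) := by
    intro x hx
    rw [graphFace_eq hG] at hx
    have hc : Convex ℝ {x : Matrix (Fin n) (Fin n) ℝ |
        rerouteMap u v (x, x u v) ∈ graphFace (attachPath G u v)} := by
      intro x hx y hy a b ha hb hab
      have := hconv hx hy ha hb hab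
      rw [← rerouteMap_convexComb _ _ hab] at this
      simpa using this
    refine convexHull_min ?_ hc hx
    rintro _ ⟨σ, hσ, rfl⟩
    simp only [Set.mem_ofPred_eq]
    rw [permMatrix_apply']
    split_ifs with h
    · rw [rerouteMap_permMatrix_one h]
      exact hmem _ ((isAdapted_reroutePerm huv).2 ⟨hσ, h⟩)
    · rw [rerouteMap_permMatrix_zero]
      exact hmem _ (isAdapted_extendPerm.2 hσ)
  obtain ⟨x, t⟩ := p
  obtain ⟨hx, ht0, ht1⟩ := hp
  dsimp only at hx ht0 ht1
  rw [negEntry_apply, zero_sub, neg_neg] at ht1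
  -- If `x u v = 0` the fibre is a point; otherwise the weight of the top end is `t / x u v`.
  rcases (ht0.trans ht1).eq_or_lt with h | h
  · obtain rfl : t = 0 := le_antisymm (ht1.trans h.ge) ht0
    exact bottom x hx
  · have hab : (1 - t / x u v) + t / x u v = 1 := by ring
    have key := hconv (bottom x hx) (top x hx)
      (sub_nonneg.2 ((div_le_one h).2 ht1)) (div_nonneg ht0 h.le) hab
    rw [← rerouteMap_convexComb _ _ hab] at key
    convert key using 2
    refine Prod.ext ?_ ?_
    · simp [← add_smul]
    · simp [h.ne']

theorem convex_geomWedge {E : Type*} [AddCommGroup E] [Module ℝ E] [TopologicalSpace E]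
    {Q : Set E} (hQ : Convex ℝ Q) (c : E →L[ℝ] ℝ) (δ : ℝ) : Convex ℝ (geomWedge Q c δ) := by
  rintro p ⟨hp, hp0, hp1⟩ q ⟨hq, hq0, hq1⟩ a b ha hb hab
  refine ⟨hQ hp hq ha hb hab, ?_, ?_⟩
  · exact add_nonneg (mul_nonneg ha hp0) (mul_nonneg hb hq0)
  · have h1 := mul_le_mul_of_nonneg_left hp1 ha
    have h2 := mul_le_mul_of_nonneg_left hq1 hb
    have h3 : δ = a * δ + b * δ := by rw [← add_mul, hab, one_mul]
    simp only [Prod.snd_add, Prod.smul_snd, Prod.fst_add, Prod.smul_fst, map_add, map_smul,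
      smul_eq_mul]
    linarith

theorem contractMap_mem_geomWedge
    (hG : G.IsBipartiteWith (Set.range Sum.inl) (Set.range Sum.inr))
    (huv : G.Adj (Sum.inl u) (Sum.inr v)) {y : Matrix (Fin (n + 1)) (Fin (n + 1)) ℝ}
    (hy : y ∈ graphFace (attachPath G u v)) :
    contractMap u v y ∈ geomWedge (graphFace G) (negEntry u v) 0 ∧
      rerouteMap u v (contractMap u v y) = y := by
  have hmem : ∀ σ, IsAdapted G σ → σ.permMatrix ℝ ∈ graphFace G := fun σ hσ => by
    rw [graphFace_eq hG]
    exact subset_convexHull ℝ _ ⟨σ, hσ, rfl⟩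
  have hW := convex_geomWedge (convex_convexHull ℝ _ : Convex ℝ (graphFace G)) (negEntry u v) 0
  rw [graphFace_eq (attachPath_isBipartiteWith hG)] at hy
  -- The inverse identity is not valid for arbitrary matrices, so it is carried along with
  -- membership and checked on the generators.
  have hc : Convex ℝ {y | contractMap u v y ∈ geomWedge (graphFace G) (negEntry u v) 0 ∧
      rerouteMap u v (contractMap u v y) = y} := by
    rintro x ⟨hx, hx'⟩ y ⟨hy, hy'⟩ a b ha hb hab
    refine ⟨?_, ?_⟩
    · rw [map_add, map_smul, map_smul]
      exact hW hx hy ha hb hab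
    · rw [map_add, map_smul, map_smul, rerouteMap_convexComb _ _ hab, hx', hy']
  refine convexHull_min ?_ hc hy
  rintro _ ⟨τ, hτ, rfl⟩
  rcases (isAdapted_attachPath_iff huv).1 hτ with ⟨σ, hσ, rfl⟩ | ⟨σ, hσ, hu, rfl⟩
  · rw [← rerouteMap_permMatrix_zero (u := u) (v := v), Set.mem_ofPred_eq, contractMap_rerouteMap]
    exact ⟨bottom_mem_geomWedge (definesFace_avoidingFace hG).1 (hmem σ hσ), rfl⟩
  · rw [← rerouteMap_permMatrix_one hu, Set.mem_ofPred_eq, contractMap_rerouteMap]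
    refine ⟨⟨hmem σ hσ, zero_le_one, ?_⟩, rfl⟩
    simp [negEntry_apply, hu]

/-- The polytope of the graph with the attached path is affinely isomorphic to a wedge. -/
theorem combEquiv_graphFace_attachPath
    (hG : G.IsBipartiteWith (Set.range Sum.inl) (Set.range Sum.inr))
    (huv : G.Adj (Sum.inl u) (Sum.inr v)) :
    CombEquiv (graphFace (attachPath G u v)) (geomWedge (graphFace G) (negEntry u v) 0) := by
  refine CombEquiv.of_affine (contractMap u v) (rerouteMap u v)
    (fun y hy => (contractMap_mem_geomWedge hG huv hy).1)
    (fun p hp => rerouteMap_mem_graphFace hG huv hp)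
    (fun y hy => (contractMap_mem_geomWedge hG huv hy).2)
    (fun p _ => contractMap_rerouteMap p) (fun l => ?_) (fun l => ?_)
  · exact ⟨l.comp (LinearMap.toContinuousLinearMap (contractMap u v)), 0, fun y _ => by simp⟩
  · exact ⟨l.comp (LinearMap.toContinuousLinearMap (rerouteLinear u v)),
      l (Matrix.single (Fin.last n) (Fin.last n) 1), fun p _ => by simp [rerouteMap]⟩

/-- A second neighbour of `u` exists by the degree condition, and a perfect matching through that
edge avoids `uv`. -/
theorem avoidingFace_nonempty [DecidableRel G.Adj] (hG : IsFaceGraph G)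
    (hu : 2 ≤ G.degree (Sum.inl u)) : (avoidingFace G s(Sum.inl u, Sum.inr v)).Nonempty := by
  obtain ⟨hb, h⟩ := isFaceGraph_iff.1 hG
  rw [← SimpleGraph.card_neighborFinset_eq_degree] at hu
  obtain ⟨b, hmem, hne⟩ := Finset.exists_mem_ne hu (Sum.inr v)
  rw [SimpleGraph.mem_neighborFinset] at hmem
  rcases b with k | k
  · have := hb.mem_of_adj hmem
    simp at this
  · obtain ⟨σ, hσ, hk⟩ := h u k hmem
    rw [avoidingFace_eq hb]
    refine ⟨_, subset_convexHull ℝ _ ⟨σ, hσ, fun h' => hne ?_, rfl⟩⟩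
    rw [← hk, h']

end AttachPath

theorem mainTheorem4 {n : ℕ} (hn : 3 ≤ n) (G : SimpleGraph (Fin n ⊕ Fin n)) [DecidableRel G.Adj]
    (hG : IsFaceGraph G) (u v : Fin n) (huv : G.Adj (Sum.inl u) (Sum.inr v))
    (hu : G.degree (Sum.inl u) = 2) (hv : G.degree (Sum.inr v) = 2) :
    IsFaceGraph (attachPath G u v) ∧
    IsExposed ℝ (birkhoffPolytope (n + 1)) (graphFace (attachPath G u v)) ∧
    (avoidingFace G s(Sum.inl u, Sum.inr v)).Nonempty ∧
    IsWedgeOver (graphFace (attachPath G u v)) (graphFace G)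
      (avoidingFace G s(Sum.inl u, Sum.inr v)) := by
  have hface := definesFace_avoidingFace (u := u) (v := v) hG.1
  exact ⟨hG.attachPath huv,
    isExposed_birkhoffPolytope_graphFace (attachPath_isBipartiteWith hG.1),
    avoidingFace_nonempty hG hu.ge, ⟨_, _, hface⟩,
    -- The wedge for `-x u v ≤ 0` is the intermediate step to the wedge for an arbitrary defining
    -- inequality.
    fun _ _ h => (combEquiv_graphFace_attachPath hG.1 huv).trans (combEquiv_geomWedge hface h)⟩
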